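/- Let $K$ be an infinite field, $n,l\ge 1$ integers, $S=K[x_1,\dots,x_n]$, and let $\lambda=(\lambda_1\ge\lambda_2\ge\cdots)$ be a partition of $n+l-1$ with $\lambda_1\ge l$. Let $\mathrm{Tab}(l,\lambda)$ be the set of fillings of the Young diagram of $\lambda$ by the multiset $\{1,\dots,1\ (l\text{ copies}),2,\dots,n\}$ such that no two copies of $1$ lie in the same column. For $T\in\mathrm{Tab}(l,\lambda)$ let $f_T\in S$ be the product, over all columns of $T$ with entries $t_1,\dots,t_k$ from top to bottom, of $\prod_{1\le i<j\le k}(x_{t_i}-x_{t_j})$, and let $I_{l,\lambda}\subseteq S$ be the ideal generated by all $f_T$, $T\in\mathrm{Tab}(l,\lambda)$. For a partition $\mu$ of $n+l-1$ let $H_{l,\mu}$ be the set of $a\in K^n$ such that the multiplicities of the distinct values in the sequence $(a_1,\dots,a_1\ (l\text{ copies}),a_2,\dots,a_n)$ form the partition $\mu$. Write $\mu\trianglelefteq\lambda$ if $\mu$ is equal to or smaller than $\lambda$ in the dominance order, i.e. $\mu_1+\cdots+\mu_i\le\lambda_1+\cdots+\lambda_i$ for all $i$. (1) The zero set of $I_{l,\lambda}$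 in $K^n$ is the union of the strata $H_{l,\mu}$ over all partitions $\mu$ of $n+l-1$ with $\mu_1\ge l$ and $\mu\not\trianglelefteq\lambda$. (2) Suppose $\lambda\neq(n+l-1)$ (equivalently, $\lambda_1<n+l-1$; for $\lambda=(n+l-1)$ the ideal is all of $S$). Then $I_{l,\lambda}$ has codimension (height) $\lambda_1-l+1$, the Krull dimension of $S/I_{l,\lambda}$ is $n+l-1-\lambda_1$, and the largest dimension of a stratum $H_{l,\mu}$ with $\mu_1\ge l$ and $\mu\not\trianglelefteq\lambda$ is $n+l-1-\lambda_1$. Here the dimension of a subset $V\subseteq K^n$ is the Krull dimension of $S$ modulo the ideal of all polynomials vanishing on $V$. -/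

import Mathlib

namespace SpechtL

/-- `row lam i` is the `(i+1)`-st largest part of the partition `lam`, and `0` if `lam` has at
most `i` parts. In particular `row lam 0` is the largest part. -/
def row {m : ℕ} (lam : Nat.Partition m) (i : ℕ) : ℕ :=
  (lam.parts.sort (· ≥ ·)).getD i 0

/-- `Dom lam mu`: the partition `mu` is equal to or smaller than `lam` in the dominance order. -/
def Dom {m : ℕ} (lam mu : Nat.Partition m) : Prop :=
  ∀ i : ℕ, ∑ j ∈ Finset.range i, row mu j ≤ ∑ j ∈ Finset.range i, row lam j

/-- The Young diagram whose row lengths are the parts of `lam` in non-increasing order. -/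
def diagram {m : ℕ} (lam : Nat.Partition m) : YoungDiagram :=
  YoungDiagram.ofRowLens (lam.parts.sort (· ≥ ·)) (lam.parts.pairwise_sort (· ≥ ·)).sortedGE

/-- Fillings of the Young diagram of `lam` by the multiset with `l` copies of the first element
`0 : Fin n` and one copy of each other element of `Fin n`, such that no two copies of `0` lie in
the same column. Positions are pairs (row, column) counted from `0`; positions outside the diagram
carry the dummy value `0`. -/
structure Tableau (n l : ℕ) [NeZero n] (lam : Nat.Partition (n + l - 1)) where
  entry : ℕ → ℕ → Fin n
  entry_outside : ∀ i j, (i, j) ∉ diagram lam → entry i j = 0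
  content : ∀ k : Fin n,
    ((diagram lam).cells.filter fun c => entry c.1 c.2 = k).card = if k = 0 then l else 1
  firsts : ∀ i i' j, (i, j) ∈ diagram lam → (i', j) ∈ diagram lam →
    entry i j = 0 → entry i' j = 0 → i = i'

/-- The Specht polynomial of a tableau: the product over all columns of the difference product of
the entries, read from top to bottom. -/
noncomputable def spechtPoly (K : Type*) [Field K] {n l : ℕ} [NeZero n]
    {lam : Nat.Partition (n + l - 1)} (T : Tableau n l lam) : MvPolynomial (Fin n) K :=
  ∏ j ∈ Finset.range ((diagram lam).rowLen 0), ∏ i' ∈ Finset.range ((diagram lam).colLen j),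
    ∏ i ∈ Finset.range i', (MvPolynomial.X (T.entry i j) - MvPolynomial.X (T.entry i' j))

/-- The ideal generated by the Specht polynomials of all tableaux of shape `lam`. -/
noncomputable def spechtIdeal (K : Type*) [Field K] (n l : ℕ) [NeZero n]
    (lam : Nat.Partition (n + l - 1)) : Ideal (MvPolynomial (Fin n) K) :=
  Ideal.span (Set.range fun T : Tableau n l lam => spechtPoly K T)

/-- The multiset consisting of `l` copies of the first coordinate of `a` and one copy of each
other coordinate. -/
def repeatFirst {K : Type*} {n : ℕ} [NeZero n] (l : ℕ) (a : Fin n → K) : Sym K (n + l - 1) :=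
  ⟨Multiset.replicate l (a 0) + ((Finset.univ.erase (0 : Fin n)).val.map a), by
    have h : 0 < n := Nat.pos_of_neZero n
    simp [-Finset.erase_val]
    omega⟩

open Classical in
/-- The partition formed by the multiplicities of the distinct values in `repeatFirst l a`. -/
noncomputable def pointType {K : Type*} {n : ℕ} [NeZero n] (l : ℕ) (a : Fin n → K) :
    Nat.Partition (n + l - 1) :=
  Nat.Partition.ofSym (repeatFirst l a)

/-- The set of all points of type `mu`. -/
def stratum (K : Type*) {n : ℕ} [NeZero n] (l : ℕ) (mu : Nat.Partition (n + l - 1)) :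
    Set (Fin n → K) :=
  {a | pointType l a = mu}

/-- The dimension of a subset of affine space: the Krull dimension of the coordinate ring of its
Zariski closure, the polynomial ring modulo all polynomials vanishing on the set
(`⊥` for the empty set). -/
noncomputable def affineDim {K : Type*} [Field K] {n : ℕ} (V : Set (Fin n → K)) : WithBot ℕ∞ :=
  ringKrullDim (MvPolynomial (Fin n) K ⧸ MvPolynomial.vanishingIdeal K V)

end SpechtL

/-! ### Rows of a partition and the dominance order -/

namespace SpechtL

open Finset

/-! Write `m = n + l - 1`. For a point `a` with coordinates in a domain, `f_T(a) ≠ 0` exactly when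
substituting `a` into `T` leaves no repeated value in a column. Such a `T` exists if and only if the
type of `a` is dominated by `lam`: `i` values fill at most as many cells as the first `i` rows
contain, and conversely the filling by row indices can be deformed to any dominated content. Hence
`a` kills the ideal iff its type is not dominated by `lam` (`spechtIdeal_le_ker_aeval_iff`); points
over `K` give (1).

For (2), apply this to the generic point of a prime `P` containing the ideal. A type not dominated
by `lam` has at most `m - λ₁` parts, so the generic point has at most that many distinct
coordinates, and `P` contains the ideal of a linear subspace of at most that dimension
(`exists_ker_rename_le`). This bounds the dimension above and the height below. Both bounds are
attained by identifying the first `λ₁ - l + 2` coordinates: the resulting type has first row greater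
than `λ₁`, so the subspace lies in the zero set. -/

theorem mem_diagram {m : ℕ} (lam : Nat.Partition m) (i j : ℕ) :
    (i, j) ∈ diagram lam ↔ j < row lam i := by
  unfold diagram row
  rw [YoungDiagram.mem_ofRowLens]
  by_cases h : i < (lam.parts.sort (· ≥ ·)).length
  · rw [List.getD_eq_getElem _ _ h]
    exact ⟨fun ⟨_, h'⟩ => h', fun h' => ⟨h, h'⟩⟩
  · rw [List.getD_eq_default _ _ (not_lt.1 h)]
    simp only [Nat.not_lt_zero, iff_false, not_exists]
    exact fun h' => absurd h' h

theorem rowLen_diagram {m : ℕ} (lam : Nat.Partition m) (i : ℕ) :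
    (diagram lam).rowLen i = row lam i :=
  eq_of_forall_lt_iff fun j => by rw [← YoungDiagram.mem_iff_lt_rowLen, mem_diagram]

theorem row_antitone {m : ℕ} (lam : Nat.Partition m) : Antitone (row lam) := fun i j h => by
  rw [← rowLen_diagram, ← rowLen_diagram]
  exact (diagram lam).rowLen_anti _ _ h

theorem row_pos {m : ℕ} (lam : Nat.Partition m) {i : ℕ} (h : i < lam.parts.card) :
    0 < row lam i := by
  have h' : i < (lam.parts.sort (· ≥ ·)).length := by simpa using h
  unfold row
  rw [List.getD_eq_getElem _ _ h']
  exact lam.parts_pos ((Multiset.mem_sort _).1 (List.getElem_mem h'))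

theorem _root_.List.sum_range_getD_zero (L : List ℕ) (i : ℕ) :
    ∑ j ∈ range i, L.getD j 0 = (L.take i).sum := by
  induction L generalizing i with
  | nil => simp
  | cons x L ih =>
    cases i with
    | zero => simp
    | succ i => rw [sum_range_succ']; simp [← ih, add_comm]

theorem sum_row_eq {m : ℕ} (lam : Nat.Partition m) {i : ℕ} (h : lam.parts.card ≤ i) :
    ∑ j ∈ range i, row lam j = m := by
  unfold row
  rw [List.sum_range_getD_zero, List.take_of_length_le (by simpa using h), ← Multiset.sum_coe,
    Multiset.sort_eq, lam.parts_sum]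

theorem sum_row_le {m : ℕ} (lam : Nat.Partition m) (i : ℕ) : ∑ j ∈ range i, row lam j ≤ m := by
  exact (sum_le_sum_of_subset (range_subset_range.2 (le_max_left _ _))).trans_eq
    (sum_row_eq lam (le_max_right i lam.parts.card))

/-- A partition with more than `m - row lam 0` parts is dominated by `lam`. -/
theorem card_parts_add_row_le_of_not_dom {m : ℕ} {lam mu : Nat.Partition m} (h : ¬ Dom lam mu) :
    mu.parts.card + row lam 0 ≤ m := by
  by_contra! hlt
  refine h fun i => ?_
  rcases i with _ | i
  · simp
  -- Each part of `mu` beyond the first `i + 1` contributes at least `1`.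
  have hmu : ∑ j ∈ range (i + 1), row mu j + (mu.parts.card - (i + 1)) ≤ m := by
    rcases le_total mu.parts.card (i + 1) with hc | hc
    · rw [Nat.sub_eq_zero_of_le hc]; exact sum_row_le mu _
    · refine le_trans ?_ (sum_row_eq mu le_rfl).le
      rw [← sum_range_add_sum_Ico _ hc]
      gcongr
      calc mu.parts.card - (i + 1) = ∑ _j ∈ Ico (i + 1) mu.parts.card, 1 := by simp
        _ ≤ _ := sum_le_sum fun j hj => row_pos mu (mem_Ico.1 hj).2
  rcases lt_or_ge i lam.parts.card with hi | hi
  · have : i + row lam 0 ≤ ∑ j ∈ range (i + 1), row lam j := by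
      rw [sum_range_succ']
      gcongr
      calc i = ∑ _j ∈ range i, 1 := by simp
        _ ≤ _ := sum_le_sum fun j hj => row_pos lam (by have := mem_range.1 hj; omega)
    omega
  · rw [sum_row_eq lam (hi.trans (Nat.le_succ i))]
    exact sum_row_le mu _

/-! ### Column-injective fillings with prescribed content -/

theorem card_filter_fst_lt (μ : YoungDiagram) (i : ℕ) :
    #{x ∈ μ.cells | x.1 < i} = ∑ j ∈ range i, μ.rowLen j := by
  rw [card_eq_sum_card_fiberwise (f := Prod.fst) (t := range i)
    (fun x hx => by simpa using (mem_filter.1 hx).2)]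
  refine sum_congr rfl fun j hj => ?_
  rw [YoungDiagram.rowLen_eq_card, YoungDiagram.row, filter_filter]
  congr 1
  ext x
  simp only [mem_filter, and_congr_right_iff]
  have := mem_range.1 hj
  omega

/-- A filling of a Young diagram without repetitions in the columns. -/
def ColumnInjective {α : Type*} (μ : YoungDiagram) (ψ : ℕ × ℕ → α) : Prop :=
  ∀ x ∈ μ.cells, ∀ y ∈ μ.cells, x.2 = y.2 → ψ x = ψ y → x = y

theorem card_filter_eq_sub (s : Finset (ℕ × ℕ)) (ψ : ℕ × ℕ → ℕ) (k : ℕ) :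
    #{x ∈ s | ψ x < k + 1} = #{x ∈ s | ψ x < k} + #{x ∈ s | ψ x = k} := by
  rw [← card_union_of_disjoint]
  · congr 1
    ext x
    simp only [mem_filter, mem_union]
    rw [Nat.lt_succ_iff, le_iff_lt_or_eq]
    tauto
  · rw [disjoint_filter]
    intro x _ h1 h2
    omega

/-- By column injectivity, the multiplicity of an entry is the number of columns containing it. So
some column contains `p` but not `r`, and its `p` can be replaced by `r`. -/
theorem ColumnInjective.exists_update {μ : YoungDiagram} {ψ : ℕ × ℕ → ℕ}
    (hψ : ColumnInjective μ ψ) {p r : ℕ} (h : #{x ∈ μ.cells | ψ x = r} < #{x ∈ μ.cells | ψ x = p}) :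
    ∃ x ∈ μ.cells, ψ x = p ∧ ColumnInjective μ (Function.update ψ x r) := by
  obtain ⟨x, hx, hxp, hxr⟩ : ∃ x ∈ μ.cells, ψ x = p ∧ ∀ y ∈ μ.cells, y.2 = x.2 → ψ y ≠ r := by
    by_contra! hcon
    have hinj : ∀ k, Set.InjOn Prod.snd (({x ∈ μ.cells | ψ x = k} : Finset (ℕ × ℕ)) : Set (ℕ × ℕ)) := by
      intro k x hx y hy hxy
      simp only [coe_filter, Set.mem_ofPred_eq] at hx hy
      exact hψ x hx.1 y hy.1 hxy (hx.2.trans hy.2.symm)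
    rw [← card_image_of_injOn (hinj r), ← card_image_of_injOn (hinj p)] at h
    refine absurd (card_le_card ?_) (not_le.2 h)
    intro j hj
    obtain ⟨x, hx, rfl⟩ := mem_image.1 hj
    obtain ⟨y, hy, hyx, hyr⟩ := hcon x (mem_filter.1 hx).1 (mem_filter.1 hx).2
    exact mem_image.2 ⟨y, mem_filter.2 ⟨hy, hyr⟩, hyx⟩
  refine ⟨x, hx, hxp, fun y hy z hz hyz h' => ?_⟩
  by_cases h1 : y = x <;> by_cases h2 : z = x
  · rw [h1, h2]
  · subst h1
    rw [Function.update_self, Function.update_of_ne h2] at h'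
    exact absurd h'.symm (hxr z hz hyz.symm)
  · subst h2
    rw [Function.update_self, Function.update_of_ne h1] at h'
    exact absurd h' (hxr y hy hyz)
  · rw [Function.update_of_ne h1, Function.update_of_ne h2] at h'
    exact hψ y hy z hz hyz h'

/-- A column-injective filling whose content dominates an antitone sequence can be changed, one
cell at a time, into a column-injective filling whose content is that sequence. -/
theorem ColumnInjective.exists_content_eq {μ : YoungDiagram} {c : ℕ → ℕ} (hc : Antitone c) (N : ℕ)
    {ψ : ℕ × ℕ → ℕ} (hψ : ColumnInjective μ ψ)
    (hle : ∀ i, ∑ j ∈ range i, c j ≤ #{x ∈ μ.cells | ψ x < i})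
    (heq : ∀ i, N ≤ i → ∑ j ∈ range i, c j = #{x ∈ μ.cells | ψ x < i}) :
    ∃ φ : ℕ × ℕ → ℕ, ColumnInjective μ φ ∧ ∀ k, #{x ∈ μ.cells | φ x = k} = c k := by
  -- Raising an entry lowers the cumulative counts, so their sum serves as the measure.
  induction hd : ∑ i ∈ range N, #{x ∈ μ.cells | ψ x < i} using Nat.strong_induction_on
    generalizing ψ with
  | _ d ih =>
  subst hd
  by_cases hall : ∀ i, ∑ j ∈ range i, c j = #{x ∈ μ.cells | ψ x < i}
  · refine ⟨ψ, hψ, fun k => ?_⟩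
    have h1 := hall (k + 1)
    rw [sum_range_succ, card_filter_eq_sub, hall k] at h1
    omega
  · push Not at hall
    classical
    -- The cumulative counts first differ at `p + 1` and next agree at `r + 1`; strictly between `p`
    -- and `r + 1` there is slack.
    obtain ⟨p, hp⟩ : ∃ p, Nat.find hall = p + 1 := Nat.exists_eq_succ_of_ne_zero fun h0 => by
      have := Nat.find_spec hall
      rw [h0] at this
      simp at this
    have hp1 := Nat.find_spec hall
    rw [hp] at hp1
    have hp0 : ∑ j ∈ range p, c j = #{x ∈ μ.cells | ψ x < p} :=
      not_not.1 (Nat.find_min hall (m := p) (by omega))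
    have hpN : p + 1 < N := by
      by_contra! h
      exact hp1 (heq _ h)
    have hex : ∃ q, p + 1 < q ∧ ∑ j ∈ range q, c j = #{x ∈ μ.cells | ψ x < q} :=
      ⟨N, hpN, heq N le_rfl⟩
    obtain ⟨r, hr⟩ : ∃ r, Nat.find hex = r + 1 :=
      Nat.exists_eq_succ_of_ne_zero (by have := (Nat.find_spec hex).1; omega)
    obtain ⟨hr1, hr2⟩ := Nat.find_spec hex
    rw [hr] at hr1 hr2
    have hrN : r + 1 ≤ N := hr ▸ Nat.find_min' hex ⟨hpN, heq N le_rfl⟩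
    have hbetween : ∀ i, p < i → i ≤ r → ∑ j ∈ range i, c j < #{x ∈ μ.cells | ψ x < i} := by
      intro i hi1 hi2
      refine lt_of_le_of_ne (hle i) fun h => ?_
      rcases eq_or_lt_of_le (Nat.succ_le_of_lt hi1) with h' | h'
      · subst h'; exact hp1 h
      · exact Nat.find_min hex (m := i) (by omega) ⟨h', h⟩
    -- The multiplicity of `r` is below `c r ≤ c p`, which is below the multiplicity of `p`.
    have hcnt : #{x ∈ μ.cells | ψ x = r} < #{x ∈ μ.cells | ψ x = p} := by
      have h1 := hbetween (p + 1) (by omega) (by omega)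
      have h2 := hbetween r (by omega) le_rfl
      rw [sum_range_succ, card_filter_eq_sub] at h1 hr2
      have h3 := hc (show p ≤ r by omega)
      omega
    obtain ⟨x, hx, hxp, hψ'⟩ := hψ.exists_update hcnt
    have hS1 : ∀ i, p < i → i ≤ r →
        #{y ∈ μ.cells | Function.update ψ x r y < i} + 1 = #{y ∈ μ.cells | ψ y < i} := by
      intro i hi1 hi2
      rw [← card_erase_add_one (mem_filter.2 ⟨hx, hxp ▸ hi1⟩ : x ∈ {y ∈ μ.cells | ψ y < i})]
      congr 2
      ext y
      by_cases hy : y = x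
      · subst hy; simp; omega
      · simp [hy]
    have hS2 : ∀ i, ¬ (p < i ∧ i ≤ r) →
        #{y ∈ μ.cells | Function.update ψ x r y < i} = #{y ∈ μ.cells | ψ y < i} := by
      intro i hi
      congr 1
      refine filter_congr fun y _ => ?_
      by_cases hy : y = x
      · subst hy; rw [Function.update_self]; omega
      · rw [Function.update_of_ne hy]
    refine ih _ ?_ hψ' ?_ ?_ rfl
    · refine sum_lt_sum (fun i _ => ?_) ⟨p + 1, mem_range.2 hpN, ?_⟩
      · by_cases hi : p < i ∧ i ≤ r
        · have := hS1 i hi.1 hi.2; omega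
        · exact (hS2 i hi).le
      · have := hS1 (p + 1) (by omega) (by omega); omega
    · intro i
      by_cases hi : p < i ∧ i ≤ r
      · have := hS1 i hi.1 hi.2; have := hbetween i hi.1 hi.2; omega
      · rw [hS2 i hi]; exact hle i
    · intro i hi
      rw [hS2 i (by omega)]; exact heq i hi

theorem exists_columnInjective_of_dom {m : ℕ} {lam mu : Nat.Partition m} (h : Dom lam mu) :
    ∃ φ : ℕ × ℕ → ℕ, ColumnInjective (diagram lam) φ ∧
      ∀ k, #{x ∈ (diagram lam).cells | φ x = k} = row mu k := by
  -- The starting filling puts its row index in each cell and has content `lam`.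
  refine ColumnInjective.exists_content_eq (row_antitone mu)
    (max mu.parts.card lam.parts.card) (ψ := Prod.fst) ?_ ?_ ?_
  · exact fun x _ y _ h1 h2 => Prod.ext h2 h1
  · intro i
    rw [card_filter_fst_lt]
    simpa only [rowLen_diagram] using h i
  · intro i hi
    rw [card_filter_fst_lt]
    simp only [rowLen_diagram]
    rw [sum_row_eq mu (by omega), sum_row_eq lam (by omega)]

/-- The cells whose entries belong to a set of `i` values are at most as many as the cells in the
first `i` rows. -/
theorem ColumnInjective.card_filter_mem_le {α : Type*} [DecidableEq α] {μ : YoungDiagram}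
    {ψ : ℕ × ℕ → α} (hψ : ColumnInjective μ ψ) (A : Finset α) {i : ℕ} (hA : #A ≤ i) :
    #{x ∈ μ.cells | ψ x ∈ A} ≤ ∑ j ∈ range i, μ.rowLen j := by
  rw [← card_filter_fst_lt,
    card_eq_sum_card_fiberwise (f := Prod.snd) (t := μ.cells.image Prod.snd)
      (fun x hx => mem_image_of_mem _ (mem_filter.1 hx).1),
    card_eq_sum_card_fiberwise (s := {x ∈ μ.cells | x.1 < i}) (f := Prod.snd)
      (t := μ.cells.image Prod.snd) (fun x hx => mem_image_of_mem _ (mem_filter.1 hx).1)]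
  refine sum_le_sum fun j _ => ?_
  -- Compare column by column: the first `i` rows meet column `j` in exactly this many cells, which
  -- is also an upper bound for the cells with entry in `A`.
  have hright : #{x ∈ {x ∈ μ.cells | x.1 < i} | x.2 = j} = min i (μ.colLen j) := by
    let e : ℕ ↪ ℕ × ℕ := ⟨fun k => (k, j), fun _ _ h => (Prod.ext_iff.1 h).1⟩
    suffices h : ({x ∈ {x ∈ μ.cells | x.1 < i} | x.2 = j} : Finset (ℕ × ℕ)) =
        (range (min i (μ.colLen j))).map e by
      rw [h, card_map, card_range]
    ext ⟨k, j'⟩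
    simp only [mem_filter, mem_map, mem_range, YoungDiagram.mem_cells,
      YoungDiagram.mem_iff_lt_colLen, lt_min_iff]
    constructor
    · rintro ⟨⟨h1, h2⟩, rfl⟩; exact ⟨k, ⟨h2, h1⟩, rfl⟩
    · rintro ⟨k', ⟨h1, h2⟩, h⟩
      obtain ⟨rfl, rfl⟩ : k' = k ∧ j = j' := Prod.ext_iff.1 h
      exact ⟨⟨h2, h1⟩, rfl⟩
  rw [hright, le_min_iff]
  constructor
  · refine le_trans (card_le_card_of_injOn ψ ?_ ?_) hA
    · intro x hx
      exact (mem_filter.1 (mem_filter.1 hx).1).2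
    · intro x hx y hy hxy
      simp only [coe_filter, mem_filter, Set.mem_ofPred_eq] at hx hy
      exact hψ x hx.1.1 y hy.1.1 (hx.2.trans hy.2.symm) hxy
  · rw [YoungDiagram.colLen_eq_card]
    refine card_le_card fun x hx => ?_
    simp only [mem_filter] at hx
    exact mem_filter.2 ⟨hx.1.1, hx.2⟩

end SpechtL

/-! ### Types of points and tableaux -/

namespace SpechtL

open Finset

/-- The values carry no order, only their multiplicities are sorted; the sorting permutation is
lifted to the values through `List.Forall₂`. -/
theorem exists_list_dedup_sort {α : Type*} [DecidableEq α] (s : Multiset α) :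
    ∃ L : List α, L.Nodup ∧ (∀ x, x ∈ L ↔ x ∈ s) ∧
      (s.dedup.map fun x => s.count x).sort (· ≥ ·) = L.map fun x => s.count x := by
  have h1 : ((s.dedup.map fun x => s.count x).sort (· ≥ ·)).Perm
      (s.dedup.toList.map fun x => s.count x) := by
    rw [← Multiset.coe_eq_coe, Multiset.sort_eq, ← Multiset.map_coe, Multiset.coe_toList]
  have h2 : List.Forall₂ (fun m x => m = s.count x) (s.dedup.toList.map fun x => s.count x)
      s.dedup.toList := by
    rw [List.forall₂_map_left_iff, List.forall₂_same]
    exact fun _ _ => rfl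
  obtain ⟨L, hL1, hL2⟩ := List.perm_comp_forall₂ h1 h2
  refine ⟨L, ?_, fun x => ?_, ?_⟩
  · rw [hL2.nodup_iff, ← Multiset.coe_nodup, Multiset.coe_toList]
    exact s.nodup_dedup
  · rw [hL2.mem_iff, Multiset.mem_toList, Multiset.mem_dedup]
  · rw [← List.forall₂_eq_eq_eq, List.forall₂_map_right_iff]
    exact hL1

open Classical in
/-- The rows of the type of a point are the multiplicities of its values. -/
theorem exists_list_row_pointType {α : Type*} {n : ℕ} [NeZero n] (l : ℕ) (a : Fin n → α) :
    ∃ L : List α, L.Nodup ∧ (∀ x, x ∈ L ↔ x ∈ (repeatFirst l a).1) ∧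
      ∀ i, row (pointType l a) i =
        (L.map fun x => (repeatFirst l a).1.count x).getD i 0 := by
  obtain ⟨L, h1, h2, h3⟩ := exists_list_dedup_sort (repeatFirst l a).1
  refine ⟨L, h1, h2, fun i => ?_⟩
  rw [← h3]
  rfl

open Classical in
theorem card_parts_pointType {α : Type*} {n : ℕ} [NeZero n] {l : ℕ} (hl : 1 ≤ l)
    (a : Fin n → α) : (pointType l a).parts.card = (Set.range a).ncard := by
  have : (pointType l a).parts.card = #(repeatFirst l a).1.toFinset := by
    change ((repeatFirst l a).1.dedup.map _).card = _
    rw [Multiset.card_map]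
    rfl
  rw [this, ← Set.ncard_coe_finset]
  congr 1
  ext x
  have : x ∈ (repeatFirst l a).1 ↔ (l ≠ 0 ∧ x = a 0) ∨ ∃ k, k ≠ 0 ∧ a k = x := by
    simp [repeatFirst, Multiset.mem_replicate, -Finset.erase_val]
  rw [mem_coe, Multiset.mem_toFinset, this]
  constructor
  · rintro (⟨-, rfl⟩ | ⟨k, -, rfl⟩)
    exacts [⟨0, rfl⟩, ⟨k, rfl⟩]
  · rintro ⟨k, rfl⟩
    by_cases hk : k = 0
    · subst hk; exact Or.inl ⟨by omega, rfl⟩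
    · exact Or.inr ⟨k, hk, rfl⟩

theorem row_zero_pointType {α : Type*} [DecidableEq α] {n : ℕ} [NeZero n] (l : ℕ) (a : Fin n → α) (x : α) :
    (repeatFirst l a).1.count x ≤ row (pointType l a) 0 := by
  by_cases hx : x ∈ (repeatFirst l a).1
  · obtain ⟨L, -, h2, h3⟩ := exists_list_row_pointType l a
    obtain ⟨i, hi, rfl⟩ := List.getElem_of_mem ((h2 x).2 hx)
    refine le_trans (le_of_eq ?_) (row_antitone (pointType l a) (Nat.zero_le i))
    rw [h3, List.getD_eq_getElem _ _ (by simpa using hi), List.getElem_map]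
    congr!
  · rw [Multiset.count_eq_zero.2 hx]
    exact Nat.zero_le _

theorem le_row_zero_pointType {α : Type*} {n : ℕ} [NeZero n] (l : ℕ) (a : Fin n → α) :
    l ≤ row (pointType l a) 0 := by
  classical
  refine le_trans ?_ (row_zero_pointType l a (a 0))
  simp [repeatFirst, -Finset.erase_val]

/-- The type sees only which coordinates coincide. This allows passing between an identification
`σ`, its generic point `X ∘ σ` and the points `b ∘ σ`. -/
theorem pointType_comp {α β : Type*} {n : ℕ} [NeZero n] (l : ℕ) (a : Fin n → α) {b : α → β}
    (hb : Function.Injective b) : pointType l (b ∘ a) = pointType l a := by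
  classical
  have h : (repeatFirst l (b ∘ a)).1 = (repeatFirst l a).1.map b := by
    simp [repeatFirst, -Finset.erase_val]
  ext1
  change (repeatFirst l (b ∘ a)).1.dedup.map _ = (repeatFirst l a).1.dedup.map _
  rw [h, Multiset.dedup_map_of_injective hb, Multiset.map_map]
  refine Multiset.map_congr rfl fun x _ => ?_
  exact Multiset.count_map_eq_count' b _ hb x

open Classical in
theorem card_filter_entry {α : Type*} {n l : ℕ} [NeZero n] {lam : Nat.Partition (n + l - 1)}
    (T : Tableau n l lam) (a : Fin n → α) (x : α) :
    #{c ∈ (diagram lam).cells | a (T.entry c.1 c.2) = x} = (repeatFirst l a).1.count x := by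
  have h : (diagram lam).cells.val.map (fun c => T.entry c.1 c.2) =
      Multiset.replicate l 0 + (univ.erase (0 : Fin n)).val := by
    ext k
    rw [Multiset.count_map, Multiset.count_add, Multiset.count_replicate]
    have := T.content k
    rw [card_def, filter_val] at this
    simp only [eq_comm (a := k)]
    rw [this]
    by_cases hk : k = 0
    · subst hk; simp
    · rw [if_neg hk, if_neg (Ne.symm hk), Multiset.count_eq_one_of_mem (nodup _)
        (show k ∈ univ.erase (0 : Fin n) from mem_erase.2 ⟨hk, mem_univ _⟩)]
  have h' : (repeatFirst l a).1 =
      ((diagram lam).cells.val.map (fun c => T.entry c.1 c.2)).map a := by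
    rw [h]; simp [repeatFirst, -Finset.erase_val]
  rw [h', Multiset.map_map, Multiset.count_map, card_def, filter_val]
  simp only [Function.comp_apply, eq_comm]

/-- The first `i` rows of the type count the cells carrying the `i` most frequent values, so
`ColumnInjective.card_filter_mem_le` applies. -/
theorem dom_pointType_of_columnInjective {α : Type*} {n l : ℕ} [NeZero n]
    {lam : Nat.Partition (n + l - 1)} (T : Tableau n l lam) (a : Fin n → α)
    (hT : ColumnInjective (diagram lam) fun c => a (T.entry c.1 c.2)) :
    Dom lam (pointType l a) := by
  classical
  intro i
  obtain ⟨L, h1, h2, h3⟩ := exists_list_row_pointType l a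
  simp only [h3]
  rw [List.sum_range_getD_zero, ← List.map_take, ← List.sum_toFinset _ (h1.sublist (L.take_sublist i))]
  have := hT.card_filter_mem_le (L.take i).toFinset (i := i)
    ((List.toFinset_card_le _).trans (List.length_take_le _ _))
  simp only [rowLen_diagram] at this
  refine le_trans (le_of_eq ?_) this
  refine Eq.trans ?_ (card_eq_sum_card_fiberwise (f := fun c : ℕ × ℕ => a (T.entry c.1 c.2))
    (t := (L.take i).toFinset) (fun c hc => (mem_filter.1 hc).2)).symm
  refine sum_congr rfl fun x hx => ?_
  rw [← card_filter_entry T, filter_filter]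
  congr 1
  refine filter_congr fun c _ => ⟨fun h => ⟨?_, h⟩, fun h => h.2⟩
  exact mem_coe.2 (by simpa only [h] using hx)

/-- The entries available for a tableau: `l` copies of `0` and one copy of each other index. -/
def letter (n l : ℕ) [NeZero n] : Fin l ⊕ {k : Fin n // k ≠ 0} → Fin n :=
  Sum.elim (fun _ => 0) Subtype.val

theorem card_letter_fiber {α : Type*} [DecidableEq α] {n : ℕ} [NeZero n] (l : ℕ) (a : Fin n → α)
    (x : α) : #{s | a (letter n l s) = x} = (repeatFirst l a).1.count x := by
  have h0 : (univ : Finset {k : Fin n // k ≠ 0}).val.map Subtype.val = (univ.erase 0).val := by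
    refine (Multiset.Nodup.ext (univ.nodup.map Subtype.val_injective) (nodup _)).2 fun k => ?_
    simp [-Finset.erase_val]
  have h : (repeatFirst l a).1 =
      (univ : Finset (Fin l ⊕ {k : Fin n // k ≠ 0})).val.map (a ∘ letter n l) := by
    rw [← univ_disjSum_univ, val_disjSum, Multiset.disjSum, Multiset.map_add, Multiset.map_map,
      Multiset.map_map]
    refine congrArg₂ (· + ·) ?_ ?_
    · refine Eq.trans ?_ (Multiset.map_const' (univ : Finset (Fin l)).val (a 0)).symm
      rw [card_val, card_univ, Fintype.card_fin]
    · rw [← h0, Multiset.map_map]; rfl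
  rw [h, Multiset.count_map, card_def, filter_val]
  simp only [Function.comp_apply, eq_comm]

theorem card_letter_fiber_self (n l : ℕ) [NeZero n] (k : Fin n) :
    #{s | letter n l s = k} = if k = 0 then l else 1 := by
  refine (card_letter_fiber l id k).trans ?_
  change Multiset.count k (Multiset.replicate l 0 + ((univ.erase (0 : Fin n)).val.map id)) = _
  rw [Multiset.map_id, Multiset.count_add, Multiset.count_replicate]
  by_cases hk : k = 0
  · subst hk; simp
  · rw [if_neg (Ne.symm hk), if_neg hk, Multiset.count_eq_one_of_mem (nodup _)
      (show k ∈ univ.erase (0 : Fin n) from mem_erase.2 ⟨hk, mem_univ _⟩)]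

theorem card_subtype_cells (s : Finset (ℕ × ℕ)) (p : ℕ × ℕ → Prop) [DecidablePred p] :
    #{c : s | p c} = #{c ∈ s | p c} := by
  rw [← card_map (Function.Embedding.subtype (· ∈ s))]
  congr 1
  ext ⟨i, j⟩
  simp [and_comm]

/-- A column-injective filling with content the type of `a` prescribes a value for each cell. Each
value is prescribed as often as letters take it, so the cells can be matched with letters of the
right value. -/
theorem exists_tableau_of_dom {α : Type*} {n l : ℕ} [NeZero n]
    {lam : Nat.Partition (n + l - 1)} {a : Fin n → α} (h : Dom lam (pointType l a)) :
    ∃ T : Tableau n l lam, ColumnInjective (diagram lam) fun c => a (T.entry c.1 c.2) := by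
  classical
  obtain ⟨L, h1, h2, h3⟩ := exists_list_row_pointType l a
  obtain ⟨φ, hφ, hcard⟩ := exists_columnInjective_of_dom h
  have hlt : ∀ c ∈ (diagram lam).cells, φ c < L.length := by
    intro c hc
    by_contra! hle
    have h0 : row (pointType l a) (φ c) = 0 := by
      rw [h3, List.getD_eq_default _ _ (by simpa using hle)]
    rw [← hcard, card_eq_zero, filter_eq_empty_iff] at h0
    exact h0 hc rfl
  -- The default is never reached on the diagram, by `hlt`.
  let v : ℕ → α := fun i => L.getD i (a 0)
  have hv : ∀ i, i < L.length → ∀ j, j < L.length → v i = v j → i = j := by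
    intro i hi j hj hij
    simp only [v, List.getD_eq_getElem _ _ hi, List.getD_eq_getElem _ _ hj] at hij
    exact (h1.getElem_inj_iff).1 hij
  have hcount : ∀ x, #{c ∈ (diagram lam).cells | v (φ c) = x} = (repeatFirst l a).1.count x := by
    intro x
    by_cases hx : x ∈ L
    · obtain ⟨i, hi, rfl⟩ := List.getElem_of_mem hx
      have hrow := h3 i
      rw [List.getD_eq_getElem _ _ (by simpa using hi), List.getElem_map] at hrow
      rw [← hrow, ← hcard]
      congr 1
      refine filter_congr fun c hc => ⟨fun hc' => ?_, fun hc' => ?_⟩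
      · refine hv _ (hlt c hc) _ hi (hc'.trans ?_)
        simp only [v, List.getD_eq_getElem _ _ hi]
      · simp only [v, hc', List.getD_eq_getElem _ _ hi]
    · rw [Multiset.count_eq_zero.2 fun h' => hx ((h2 x).2 h'), card_eq_zero, filter_eq_empty_iff]
      rintro c hc rfl
      apply hx
      simp only [v, List.getD_eq_getElem _ _ (hlt c hc)]
      exact List.getElem_mem _
  have hfib : ∀ x, Nonempty ({c : (diagram lam).cells // v (φ c) = x} ≃ {s // a (letter n l s) = x}) := by
    intro x
    rw [← Fintype.card_eq, Fintype.card_subtype, Fintype.card_subtype,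
      card_subtype_cells _ fun c => v (φ c) = x, hcount, ← card_letter_fiber]
  let e : (diagram lam).cells ≃ Fin l ⊕ {k : Fin n // k ≠ 0} :=
    (Equiv.sigmaFiberEquiv fun c : (diagram lam).cells => v (φ c)).symm.trans
      ((Equiv.sigmaCongrRight fun x => (hfib x).some).trans
        (Equiv.sigmaFiberEquiv fun s => a (letter n l s)))
  have he : ∀ c, a (letter n l (e c)) = v (φ c) := fun c => ((hfib (v (φ c))).some ⟨c, rfl⟩).2
  let ent : ℕ → ℕ → Fin n := fun i j =>
    if hc : (i, j) ∈ (diagram lam).cells then letter n l (e ⟨(i, j), hc⟩) else 0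
  have hent : ∀ c (hc : c ∈ (diagram lam).cells), ent c.1 c.2 = letter n l (e ⟨c, hc⟩) :=
    fun c hc => dif_pos hc
  have hinj : ColumnInjective (diagram lam) fun c => a (ent c.1 c.2) := by
    intro c hc c' hc' hcol heq
    simp only [hent c hc, hent c' hc', he] at heq
    exact hφ c hc c' hc' hcol (hv _ (hlt c hc) _ (hlt c' hc') heq)
  refine ⟨⟨ent, fun i j hij => dif_neg hij, fun k => ?_, fun i i' j h1 h2 h3 h4 => ?_⟩, hinj⟩
  · rw [← card_letter_fiber_self n l k, ← card_subtype_cells _ fun c => ent c.1 c.2 = k,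
      ← card_map e.toEmbedding]
    congr 1
    ext s
    simp only [mem_map_equiv, mem_filter, mem_univ, true_and]
    rw [hent _ (e.symm s).2, Subtype.coe_eta, Equiv.apply_symm_apply]
  -- Two copies of `0` have the same value, so column injectivity already separates them.
  · exact (Prod.ext_iff.1 (hinj (i, j) h1 (i', j) h2 rfl (by simp only [h3, h4]))).1

end SpechtL

/-! ### Commutative algebra of coordinate identifications -/

namespace SpechtL

open MvPolynomial

theorem ker_rename_isPrime (K : Type*) [Field K] {α ι : Type*} (σ : α → ι) :
    (RingHom.ker (rename (R := K) σ)).IsPrime :=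
  RingHom.ker_isPrime _

/-- Splitting one coordinate off a nontrivial fibre of `σ` gives a strictly smaller prime and at
most one new value; repeating this builds a chain of length `d`. -/
theorem le_height_ker_rename (K : Type*) [Field K] {α : Type*} [Fintype α] {ι : Type*}
    (σ : α → ι) (d : ℕ) (h : (Set.range σ).ncard + d ≤ Fintype.card α) :
    (d : ℕ∞) ≤ (RingHom.ker (rename (R := K) σ)).height := by
  classical
  induction d generalizing ι with
  | zero => simp
  | succ d ih =>
    obtain ⟨i, j, hij, hne⟩ : ∃ i j, σ i = σ j ∧ i ≠ j := by
      by_contra! hcon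
      have := Set.ncard_range_of_injective (f := σ) fun i j hij => hcon i j hij
      rw [Nat.card_eq_fintype_card] at this
      omega
    let τ : α → Option ι := Function.update (fun k => some (σ k)) i none
    have hτi : τ i = none := Function.update_self _ _ _
    have hτ : ∀ k, k ≠ i → τ k = some (σ k) := fun k hk => Function.update_of_ne hk _ _
    have hrange : Set.range τ ⊆ insert none (some '' Set.range σ) := by
      rintro _ ⟨k, rfl⟩
      by_cases hk : k = i
      · subst hk; left; exact hτi
      · right; rw [hτ k hk]; exact ⟨_, ⟨k, rfl⟩, rfl⟩
    have hcard : (Set.range τ).ncard ≤ (Set.range σ).ncard + 1 :=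
      (Set.ncard_le_ncard hrange ((Set.finite_range σ).image _ |>.insert _)).trans
        ((Set.ncard_insert_le _ _).trans
          (Nat.add_le_add_right (Set.ncard_image_le (Set.finite_range σ)) 1))
    have hcomp : ∀ f : MvPolynomial α K,
        rename (fun o : Option ι => o.getD (σ i)) (rename τ f) = rename σ f := by
      intro f
      rw [rename_rename]
      congr 2
      ext k
      by_cases hk : k = i
      · subst hk; simp [hτi]
      · simp [hτ k hk]
    have hlt : RingHom.ker (rename (R := K) τ) < RingHom.ker (rename (R := K) σ) := by
      refine lt_of_le_of_ne (fun f hf => ?_) fun heq => ?_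
      · rw [RingHom.mem_ker] at hf ⊢
        rw [← hcomp, hf, map_zero]
      · have : (X i - X j : MvPolynomial α K) ∈ RingHom.ker (rename (R := K) τ) := by
          rw [heq, RingHom.mem_ker]; simp [hij]
        rw [RingHom.mem_ker, map_sub, rename_X, rename_X, sub_eq_zero, X_injective.eq_iff, hτi,
          hτ j hne.symm] at this
        exact absurd this (by simp)
    have := ker_rename_isPrime K τ
    have := ker_rename_isPrime K σ
    push_cast
    exact (add_le_add_left (ih τ (by omega)) 1).trans
      (Ideal.height_add_one_le_of_lt_of_isPrime hlt)

/-- The coordinate ring of the image of a coordinate identification. -/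
theorem ringKrullDim_quotient_ker_rename (K : Type*) [Field K] {α ι : Type*} [Finite ι]
    {σ : α → ι} (hσ : Function.Surjective σ) :
    ringKrullDim (MvPolynomial α K ⧸ RingHom.ker (rename (R := K) σ)) = (Nat.card ι : ℕ) := by
  refine (ringKrullDim_eq_of_ringEquiv
    (RingHom.quotientKerEquivOfSurjective (f := (rename (R := K) σ).toRingHom)
      (rename_surjective σ hσ))).trans ?_
  simp

theorem _root_.ringKrullDim_quotient_antitone {R : Type*} [CommRing R] {I J : Ideal R}
    (h : I ≤ J) : ringKrullDim (R ⧸ J) ≤ ringKrullDim (R ⧸ I) :=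
  ringKrullDim_le_of_surjective (Ideal.Quotient.factor h) (Ideal.Quotient.factor_surjective h)

/-- Chains ending at `P` and chains starting at `P` concatenate. -/
theorem height_add_ringKrullDim_quotient_le {R : Type*} [CommRing R] (P : Ideal R) [P.IsPrime] :
    P.height + ringKrullDim (R ⧸ P) ≤ ringKrullDim R := by
  let p : PrimeSpectrum R := ⟨P, inferInstance⟩
  have hP : ringKrullDim (R ⧸ P) = Order.coheight p := by
    rw [ringKrullDim_quotient, Order.coheight_eq_krullDim_Ici]
    rfl
  have : Nonempty (PrimeSpectrum R) := ⟨p⟩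
  rw [hP, show P.height = Order.height p from PrimeSpectrum.height_eq_orderHeight p, ringKrullDim,
    Order.krullDim_eq_iSup_height_add_coheight_of_nonempty, ← WithBot.coe_add, WithBot.coe_le_coe]
  exact le_iSup (fun q : PrimeSpectrum R => Order.height q + Order.coheight q) p

/-- A polynomial that vanishes at all points with pairwise different coordinates is zero. -/
theorem eq_zero_of_aeval_injective {K : Type*} [Field K] [Infinite K] {k : ℕ}
    {g : MvPolynomial (Fin k) K}
    (hg : ∀ b : Fin k → K, Function.Injective b → aeval b g = 0) : g = 0 := by
  -- This product vanishes at all remaining points, so its product with `g` vanishes everywhere.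
  have hne : (∏ i, ∏ j ∈ Finset.univ.erase i, (X i - X j) : MvPolynomial (Fin k) K) ≠ 0 := by
    refine Finset.prod_ne_zero_iff.2 fun i _ => Finset.prod_ne_zero_iff.2 fun j hj => ?_
    rw [sub_ne_zero, X_injective.ne_iff]
    exact (Finset.ne_of_mem_erase hj).symm
  refine (mul_eq_zero.1 (MvPolynomial.funext fun b => ?_ :
    g * (∏ i, ∏ j ∈ Finset.univ.erase i, (X i - X j)) = 0)).resolve_right hne
  rw [map_zero, map_mul]
  by_cases hb : Function.Injective b
  · rw [← coe_aeval_eq_eval, RingHom.coe_coe, hg b hb, zero_mul]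
  · obtain ⟨i, j, hij, hne⟩ := Function.not_injective_iff.1 hb
    rw [map_prod, Finset.prod_eq_zero (Finset.mem_univ i), mul_zero]
    rw [map_prod, Finset.prod_eq_zero (Finset.mem_erase.2 ⟨hne.symm, Finset.mem_univ j⟩)]
    simp [hij]

end SpechtL

/-! ### Zero set, dimension and height of the Specht ideal -/

namespace SpechtL

open MvPolynomial

theorem aeval_spechtPoly_ne_zero_iff {K A : Type*} [Field K] [CommRing A] [IsDomain A]
    [Algebra K A] {n l : ℕ} [NeZero n] {lam : Nat.Partition (n + l - 1)} (T : Tableau n l lam)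
    (a : Fin n → A) :
    aeval a (spechtPoly K T) ≠ 0 ↔
      ColumnInjective (diagram lam) fun c => a (T.entry c.1 c.2) := by
  simp only [spechtPoly, map_prod, map_sub, aeval_X, Finset.prod_ne_zero_iff, Finset.mem_range,
    sub_ne_zero]
  constructor
  · intro h
    have key : ∀ i i' j, (i', j) ∈ diagram lam → i < i' →
        a (T.entry i j) ≠ a (T.entry i' j) := by
      intro i i' j hi' hlt
      refine h j ?_ i' (YoungDiagram.mem_iff_lt_colLen.1 hi') i hlt
      exact (YoungDiagram.mem_iff_lt_rowLen.1 hi').trans_le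
        ((diagram lam).rowLen_anti _ _ (Nat.zero_le _))
    rintro ⟨i, j⟩ hx ⟨i', j'⟩ hy hcol heq
    obtain rfl : j = j' := hcol
    rcases lt_trichotomy i i' with hlt | rfl | hlt
    · exact absurd heq (key i i' j hy hlt)
    · rfl
    · exact absurd heq.symm (key i' i j hx hlt)
  · intro h j _ i' hi' i hi heq
    have := h (i, j) (YoungDiagram.mem_iff_lt_colLen.2 (hi.trans hi')) (i', j)
      (YoungDiagram.mem_iff_lt_colLen.2 hi') rfl heq
    exact hi.ne (Prod.ext_iff.1 this).1

/-- The coordinates lie in an arbitrary domain so that generic points are covered: `A` is taken to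
be `K`, a quotient by a prime, and a polynomial ring. -/
theorem spechtIdeal_le_ker_aeval_iff {K A : Type*} [Field K] [CommRing A] [IsDomain A]
    [Algebra K A] {n l : ℕ} [NeZero n] {lam : Nat.Partition (n + l - 1)} (a : Fin n → A) :
    spechtIdeal K n l lam ≤ RingHom.ker (aeval (R := K) a) ↔ ¬ Dom lam (pointType l a) := by
  rw [spechtIdeal, Ideal.span_le]
  constructor
  · intro h hdom
    obtain ⟨T, hT⟩ := exists_tableau_of_dom hdom
    exact (aeval_spechtPoly_ne_zero_iff (K := K) T a).2 hT (h ⟨T, rfl⟩)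
  · rintro h _ ⟨T, rfl⟩
    by_contra hne
    exact h (dom_pointType_of_columnInjective T a ((aeval_spechtPoly_ne_zero_iff (K := K) T a).1 hne))

theorem zeroLocus_spechtIdeal (K : Type*) [Field K] (n l : ℕ) [NeZero n]
    (lam : Nat.Partition (n + l - 1)) :
    zeroLocus K (spechtIdeal K n l lam) =
      ⋃ mu ∈ {mu : Nat.Partition (n + l - 1) | l ≤ row mu 0 ∧ ¬ Dom lam mu}, stratum K l mu := by
  ext a
  have h : a ∈ zeroLocus K (spechtIdeal K n l lam) ↔ ¬ Dom lam (pointType l a) :=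
    spechtIdeal_le_ker_aeval_iff a
  rw [h, Set.mem_iUnion₂]
  constructor
  · exact fun hd => ⟨_, ⟨le_row_zero_pointType l a, hd⟩, rfl⟩
  · rintro ⟨mu, hmu, rfl⟩
    exact hmu.2

/-- A prime containing the ideal of Specht polynomials contains the ideal of a linear subspace
given by identifications of coordinates, of dimension at most `n + l - 1 - row lam 0`. -/
theorem exists_ker_rename_le.{u} {K : Type u} [Field K] {n l : ℕ} [NeZero n] (hl : 1 ≤ l)
    {lam : Nat.Partition (n + l - 1)} {P : Ideal (MvPolynomial (Fin n) K)} [P.IsPrime]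
    (hP : spechtIdeal K n l lam ≤ P) :
    ∃ (ι : Type u) (_ : Finite ι) (σ : Fin n → ι), Function.Surjective σ ∧
      RingHom.ker (rename (R := K) σ) ≤ P ∧ Nat.card ι + row lam 0 ≤ n + l - 1 := by
  -- The generic point of `P`; `σ` records which of its coordinates coincide.
  let a : Fin n → MvPolynomial (Fin n) K ⧸ P := fun i => Ideal.Quotient.mk P (X i)
  have ha : aeval (R := K) a = Ideal.Quotient.mkₐ K P := algHom_ext fun i => by simp [a]
  have hker : RingHom.ker (aeval (R := K) a) = P := by
    rw [ha]; exact Ideal.Quotient.mkₐ_ker K P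
  have hdom := (spechtIdeal_le_ker_aeval_iff (l := l) (lam := lam) a).1 (hker.symm ▸ hP)
  refine ⟨Set.range a, inferInstance, Set.rangeFactorization a, Set.rangeFactorization_surjective,
    fun f hf => ?_, ?_⟩
  · rw [← hker, RingHom.mem_ker]
    have h : aeval (R := K) (Subtype.val : Set.range a → _) (rename (Set.rangeFactorization a) f) =
        aeval a f := by
      rw [aeval_rename]; rfl
    rw [← h, RingHom.mem_ker.1 hf, map_zero]
  · have := card_parts_add_row_le_of_not_dom hdom
    rwa [card_parts_pointType hl] at this

theorem ringKrullDim_quotient_spechtIdeal_le (K : Type*) [Field K] {n l : ℕ} [NeZero n]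
    (hl : 1 ≤ l) (lam : Nat.Partition (n + l - 1)) :
    ringKrullDim (MvPolynomial (Fin n) K ⧸ spechtIdeal K n l lam) ≤
      ((n + l - 1 - row lam 0 : ℕ) : WithBot ℕ∞) := by
  rw [ringKrullDim_quotient]
  refine iSup_le fun p => ?_
  -- The linear ideal inside the smallest prime of the chain lies in all of them, so the chain lives
  -- in one linear subspace.
  obtain ⟨ι, _, σ, hσ, hker, hι⟩ := exists_ker_rename_le hl (P := p.head.1.asIdeal) p.head.2
  have hdim := ringKrullDim_quotient_ker_rename K hσ
  rw [ringKrullDim_quotient] at hdim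
  let q : LTSeries (PrimeSpectrum.zeroLocus (R := MvPolynomial (Fin n) K)
      (RingHom.ker (rename (R := K) σ))) :=
    { length := p.length
      toFun := fun i => ⟨(p i).1, hker.trans (p.head_le i)⟩
      step := fun i => p.step i }
  have hq : (p.length : WithBot ℕ∞) ≤ (Nat.card ι : ℕ) :=
    hdim ▸ Order.LTSeries.length_le_krullDim q
  exact hq.trans (by exact_mod_cast (by omega : Nat.card ι ≤ n + l - 1 - row lam 0))

theorem le_height_spechtIdeal (K : Type*) [Field K] {n l : ℕ} [NeZero n]
    (hl : 1 ≤ l) {lam : Nat.Partition (n + l - 1)} (hlam : l ≤ row lam 0) :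
    ((row lam 0 - l + 1 : ℕ) : ℕ∞) ≤ (spechtIdeal K n l lam).height := by
  rw [Ideal.height_eq_inf_minimalPrimes]
  refine le_iInf₂ fun P hP => ?_
  have := hP.1.1
  obtain ⟨ι, _, σ, hσ, hker, hι⟩ := exists_ker_rename_le hl hP.1.2
  refine (le_height_ker_rename K σ _ ?_).trans (Ideal.height_mono hker)
  rw [hσ.range_eq, Set.ncard_univ, Fintype.card_fin]
  omega

/-- The identification of the first `d + 1` coordinates. -/
def collapse (n d : ℕ) (hd : d < n) (i : Fin n) : Fin (n - d) :=
  -- Truncated subtraction sends `0, …, d` to `0`.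
  ⟨i - d, by have := i.2; omega⟩

theorem collapse_surjective {n d : ℕ} (hd : d < n) : Function.Surjective (collapse n d hd) :=
  fun j => ⟨⟨j + d, by have := j.2; omega⟩, Fin.ext (Nat.add_sub_cancel _ _)⟩

theorem add_le_row_zero_pointType_collapse {n l d : ℕ} [NeZero n] (hd : d < n) :
    l + d ≤ row (pointType l (collapse n d hd)) 0 := by
  classical
  refine le_trans ?_ (row_zero_pointType l _ (collapse n d hd 0))
  change _ ≤ Multiset.count _ (Multiset.replicate l _ + Multiset.map _ _)
  rw [Multiset.count_add, Multiset.count_replicate_self, Multiset.count_map]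
  refine Nat.add_le_add_left ?_ l
  rw [← Finset.filter_val, ← Finset.card_def]
  -- Besides the `l` copies of the first coordinate, coordinates `1, …, d` each add one occurrence
  -- of the value `0`.
  let e : Fin d ↪ Fin n := ⟨fun i => ⟨i + 1, by have := i.2; omega⟩, fun i j h => by
    simpa [Fin.ext_iff] using h⟩
  calc d = (Finset.univ.map e).card := by simp
    _ ≤ _ := Finset.card_le_card fun k hk => by
      obtain ⟨i, -, rfl⟩ := Finset.mem_map.1 hk
      have h0 : e i ≠ 0 := fun h => Nat.succ_ne_zero _ (congrArg Fin.val h)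
      refine Finset.mem_filter.2 ⟨Finset.mem_erase.2 ⟨h0, Finset.mem_univ _⟩, Fin.ext ?_⟩
      change ((0 : Fin n) : ℕ) - d = (i : ℕ) + 1 - d
      rw [Fin.val_zero, Nat.zero_sub, Nat.sub_eq_zero_of_le i.2]

theorem not_dom_of_row_lt {m : ℕ} {lam mu : Nat.Partition m} (h : row lam 0 < row mu 0) :
    ¬ Dom lam mu := fun hd => by
  have := hd 1
  simp only [Finset.sum_range_one] at this
  omega

end SpechtL

open SpechtL MvPolynomial in
theorem mainTheorem7 {K : Type*} [Field K] [Infinite K] (n l : ℕ) [NeZero n] (hl : 1 ≤ l)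
    (lam : Nat.Partition (n + l - 1)) (hlam : l ≤ SpechtL.row lam 0) :
    MvPolynomial.zeroLocus K (SpechtL.spechtIdeal K n l lam) =
        ⋃ mu ∈ {mu : Nat.Partition (n + l - 1) | l ≤ SpechtL.row mu 0 ∧ ¬ SpechtL.Dom lam mu},
          SpechtL.stratum K l mu ∧
    (SpechtL.row lam 0 < n + l - 1 →
      (SpechtL.spechtIdeal K n l lam).height = ((SpechtL.row lam 0 - l + 1 : ℕ) : ℕ∞) ∧
      ringKrullDim (MvPolynomial (Fin n) K ⧸ SpechtL.spechtIdeal K n l lam) =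
        ((n + l - 1 - SpechtL.row lam 0 : ℕ) : WithBot ℕ∞) ∧
      IsGreatest
        ((fun mu : Nat.Partition (n + l - 1) => SpechtL.affineDim (SpechtL.stratum K l mu)) ''
          {mu : Nat.Partition (n + l - 1) | l ≤ SpechtL.row mu 0 ∧ ¬ SpechtL.Dom lam mu})
        ((n + l - 1 - SpechtL.row lam 0 : ℕ) : WithBot ℕ∞)) := by
  refine ⟨zeroLocus_spechtIdeal K n l lam, fun hlt => ?_⟩
  -- The least `d` with `l + d > row lam 0`, which forces the collapsed type out of the dominance
  -- order ideal of `lam`.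
  have hd : row lam 0 - l + 1 < n := by omega
  have hcard : n - (row lam 0 - l + 1) = n + l - 1 - row lam 0 := by omega
  have hσ := collapse_surjective hd
  set σ := collapse n _ hd
  have hrow : l + (row lam 0 - l + 1) ≤ row (pointType l σ) 0 :=
    add_le_row_zero_pointType_collapse hd
  have hnot : ¬ Dom lam (pointType l σ) := not_dom_of_row_lt (by omega)
  have hprime := ker_rename_isPrime K σ
  have hdimσ : ringKrullDim (MvPolynomial (Fin n) K ⧸ RingHom.ker (rename (R := K) σ)) =
      ((n + l - 1 - row lam 0 : ℕ) : WithBot ℕ∞) := by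
    rw [ringKrullDim_quotient_ker_rename K hσ, Nat.card_fin, hcard]
  have hle : spechtIdeal K n l lam ≤ RingHom.ker (rename (R := K) σ) := by
    have := (spechtIdeal_le_ker_aeval_iff (K := K) (l := l) (lam := lam)
      ((X : _ → MvPolynomial _ K) ∘ σ)).2
    rw [pointType_comp l σ X_injective] at this
    intro f hf
    rw [RingHom.mem_ker, rename_eq_aeval]
    exact this hnot hf
  have hdim : ringKrullDim (MvPolynomial (Fin n) K ⧸ spechtIdeal K n l lam) =
      ((n + l - 1 - row lam 0 : ℕ) : WithBot ℕ∞) := by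
    exact le_antisymm (ringKrullDim_quotient_spechtIdeal_le K hl lam)
      (hdimσ ▸ ringKrullDim_quotient_antitone hle)
  have hub : ∀ mu, ¬ Dom lam mu →
      affineDim (stratum K l mu) ≤ ((n + l - 1 - row lam 0 : ℕ) : WithBot ℕ∞) := by
    refine fun mu hmu => hdim ▸ ringKrullDim_quotient_antitone fun f hf a ha => ?_
    obtain rfl : pointType l a = mu := ha
    exact (spechtIdeal_le_ker_aeval_iff a).2 hmu hf
  refine ⟨le_antisymm ?_ (le_height_spechtIdeal K hl hlam), hdim,
    ⟨pointType l σ, ⟨by omega, hnot⟩, le_antisymm (hub _ hnot) ?_⟩, ?_⟩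
  -- The height of the linear prime is at most `n` minus its dimension.
  · refine (Ideal.height_mono hle).trans ?_
    have h := height_add_ringKrullDim_quotient_le (RingHom.ker (rename (R := K) σ))
    rw [hdimσ, ringKrullDim_of_isNoetherianRing, ringKrullDim_eq_zero_of_field, zero_add,
      Nat.card_fin] at h
    generalize (RingHom.ker (rename (R := K) σ)).height = x at h ⊢
    have h' : x + ((n + l - 1 - row lam 0 : ℕ) : ℕ∞) ≤ (n : ℕ∞) := WithBot.coe_le_coe.1 h
    induction x using ENat.recTopCoe with
    | top => simp at h'
    | coe x =>
      have : x + (n + l - 1 - row lam 0) ≤ n := by exact_mod_cast h'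
      exact_mod_cast (by omega : x ≤ row lam 0 - l + 1)
  -- The stratum is dense in the linear subspace: it contains `b ∘ σ` for every injective `b`, so a
  -- polynomial vanishing on it is killed by `rename σ`.
  · refine hdimσ ▸ ringKrullDim_quotient_antitone fun f hf => ?_
    refine eq_zero_of_aeval_injective fun b hb => ?_
    rw [aeval_rename]
    exact hf _ (pointType_comp l σ hb)
  · rintro _ ⟨mu, hmu, rfl⟩
    exact hub mu hmu.2
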